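/- **Theorem 3.9.** Let $(\mathcal C,J)$ be a site, i.e. a small category $\mathcal C$ with a Grothendieck topology $J$. *Definitions.* Given a collection $\mathcal B(C)$ of presieves over $C$ for each object $C$ of $\mathcal C$, a *$\mathcal B$-cotree* with root $C$ is a tree-shaped diagram in $\mathcal C$ all of whose branches are finite (its width being arbitrary), in which the morphisms into each non-terminating node from its predecessors form a presieve in $\mathcal B$. That is, $\mathcal B$-cotrees are defined inductively: a $\mathcal B$-cotree with root $C$ is either trivial, or consists of a presieve $R\in\mathcal B(C)$ and a $\mathcal B$-cotree with root $D$ for every $f:D\to C$ in $R$. Its *multicomposite* is the presieve over $C$ consisting of the composites of its maximal branches; for the trivial cotree this is $\{\mathrm{id}_C\}$. A *warp* for $J$ is a collection $\mathcal B(C)$ of $J$-covering presieves over $C$ (presieves generating a $J$-covering sieve) for each object $C$ such that * the pullback along any morphism $D\to C$ of the sieve generated by a presieve in $\mathcal B(C)$ contains a presieve in $\mathcal B(D)$, and * every $J$-covering sieve over any object $C$ contains the multicomposite of a $\mathcal B$-cotree with root $C$. The site $(\mathcal C,J)$ is *$\omega$-woven* if $J$ has a warp $\mathcal B$ such that $\mathcal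 B(C)$ is countable for every object $C$. A *point* of a topos $\mathcal E$ is a geometric morphism $\mathrm{Set}\to\mathcal E$, i.e. an adjunction $p^*\dashv p_*$ with $p^*:\mathcal E\to\mathrm{Set}$ preserving finite limits; $\mathcal E$ *has enough points* if there is a set of points whose inverse image functors $p^*$ are jointly faithful. *Statement.* Assume the axiom of dependent countable choice (which holds in the usual classical foundations with choice), and let $\mathcal C$ have pullbacks. 1. If $(\mathcal C,J)$ is $\omega$-woven, then $\mathrm{Sh}(\mathcal C,J)$ has enough points. 2. (Makkai–Reyes, as a special case.) If $\mathcal C$ is countable (countably many objects and morphisms) and $J$ is generated by a countable family of sieves (it is the smallest Grothendieck topology for which they are covering), then $(\mathcal C,J)$ is $\omega$-woven, and hence $\mathrm{Sh}(\mathcal C,J)$ has enough points. -/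

import Mathlib

open CategoryTheory Limits

universe w v u

namespace WovenSite

section Points

/-- A point of a topos `E`: a geometric morphism from the topos of (`w`-small) sets to `E`, i.e. an
inverse image functor `E ⥤ Type w` that preserves finite limits and is left adjoint to a
direct image functor. -/
structure ToposPoint (E : Type u) [Category.{v} E] where
  /-- the inverse image functor -/
  inverseImage : E ⥤ Type w
  /-- the direct image functor -/
  directImage : Type w ⥤ E
  /-- the adjunction between them -/
  adj : inverseImage ⊣ directImage
  /-- the inverse image functor is left exact -/
  lex : PreservesFiniteLimits inverseImage

/-- A topos `E` has enough points: there is a (small) set of points whose inverse image functors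
are jointly faithful, that is, any two distinct parallel morphisms of `E` are sent to distinct
maps by the inverse image functor of one of these points. -/
def HasEnoughPoints (E : Type u) [Category.{v} E] : Prop :=
  ∃ (ι : Type w) (p : ι → ToposPoint.{w} E), JointlyFaithful fun i ↦ (p i).inverseImage

end Points

section Woven

variable {C : Type u} [Category.{v} C]

/-- Cotrees in `C` with root `X`, all of whose branches are finite, and in which the morphisms
into a node from its predecessors are exactly the members of a presieve in `B`; the width is
arbitrary. Such a cotree is either trivial (just the root), or consists of a presieve `R ∈ B X`
together with such a cotree on the domain of every member of `R`. -/
inductive Cotree (B : Precoverage C) : C → Type (max u v)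
  | root (X : C) : Cotree B X
  | node {X : C} (R : Presieve X) (hR : R ∈ B X)
      (sub : ∀ ⦃Y : C⦄ (f : Y ⟶ X), R f → Cotree B Y) : Cotree B X

/-- The multicomposite of a cotree: the presieve on its root that consists of the composites of
its maximal branches (only the identity, for a trivial cotree). -/
def Cotree.multicomposite {B : Precoverage C} : {X : C} → Cotree B X → Presieve X
  | _, .root X => Presieve.singleton (𝟙 X)
  | _, .node R _ sub => Presieve.bind R fun _ f hf ↦ (sub f hf).multicomposite

/-- `B` is a warp for the Grothendieck topology `J`. -/
structure IsWarp (J : GrothendieckTopology C) (B : Precoverage C) : Prop where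
  /-- every presieve in `B` is `J`-covering -/
  covering : ∀ ⦃X : C⦄ (R : Presieve X), R ∈ B X → Sieve.generate R ∈ J X
  /-- the pullback of a sieve generated by a presieve in `B` contains a presieve in `B` -/
  pullback : ∀ ⦃X Y : C⦄ (f : Y ⟶ X) (R : Presieve X), R ∈ B X →
    ∃ R' ∈ B Y, R' ≤ ((Sieve.generate R).pullback f).arrows
  /-- every `J`-covering sieve contains the multicomposite of a cotree of presieves in `B` -/
  multicomposite : ∀ ⦃X : C⦄ (S : Sieve X), S ∈ J X →
    ∃ T : Cotree B X, T.multicomposite ≤ S.arrows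

/-- The site `(C, J)` is `ω`-woven: `J` has a warp that is countable at every object. -/
def IsOmegaWoven (J : GrothendieckTopology C) : Prop :=
  ∃ B : Precoverage C, IsWarp J B ∧ ∀ X : C, (B X).Countable

/-- `J` is generated by a countable family of sieves: it is the smallest Grothendieck topology for
which all sieves of the family are covering. -/
def IsCountablyGenerated (J : GrothendieckTopology C) : Prop :=
  ∃ F : Set (Σ X : C, Sieve X), F.Countable ∧
    IsLeast {K : GrothendieckTopology C | ∀ s ∈ F, s.2 ∈ K s.1} J

end Woven

end WovenSite

/-! A family of points is conservative as soon as every non-covering sieve `S` on `X` has a point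
`Φ` and an element of `Φ(X)` hit by no member of `S`. Such a point is the filtered colimit of the
functors `Hom(p n, -)` along a sequence `... ⟶ p 1 ⟶ p 0 ⟶ X`. By `exists_sequence`, no composite `p
n ⟶ X` lies in `S`, while every presieve of the warp on some `p n` is met further along;
countability of the warp lets one sequence meet all these demands. Cotrees have finite branches, so
meeting the warp suffices for meeting every covering sieve (`exists_map_of_cotree`). For a countably
generated topology, the pullbacks of the generators form the warp: the sieves refined by cotrees
form a Grothendieck topology (`cotreeTopology`), which contains `J` by minimality. -/

open Opposite

namespace WovenSite

section Cotrees

variable {C : Type u} [Category.{v} C] {B : Precoverage C}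

/-- The sieves that contain the multicomposite of a cotree. -/
def Refines (B : Precoverage C) {X : C} (S : Sieve X) : Prop :=
  ∃ T : Cotree B X, T.multicomposite ≤ S.arrows

lemma refines_node {X : C} {S : Sieve X} {R : Presieve X} (hR : R ∈ B X)
    (h : ∀ ⦃Y : C⦄ (f : Y ⟶ X), R f → Refines B (S.pullback f)) : Refines B S := by
  choose T hT using h
  refine ⟨.node R hR T, ?_⟩
  rintro Z _ ⟨Y, g, f, hf, hg, rfl⟩
  exact hT f hf _ _ hg

lemma refines_of_mem_of_le {X : C} {R : Presieve X} (hR : R ∈ B X) {S : Sieve X}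
    (h : R ≤ S.arrows) : Refines B S :=
  refines_node hR fun Y f hf ↦ ⟨.root Y, by
    rw [Sieve.pullback_eq_top_of_mem S (h _ _ hf)]
    exact fun _ _ _ ↦ trivial⟩

/-- At a node, each member of `R'` followed by `f` factors through some `g` in `R`, so the subtree
over `g` can be pulled back in turn. -/
lemma Refines.pullback
    (hB : ∀ ⦃X Y : C⦄ (f : Y ⟶ X) (R : Presieve X), R ∈ B X →
      ∃ R' ∈ B Y, R' ≤ ((Sieve.generate R).pullback f).arrows)
    {X Y : C} {S : Sieve X} (hS : Refines B S) (f : Y ⟶ X) : Refines B (S.pullback f) := by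
  obtain ⟨T, hT⟩ := hS
  induction T generalizing Y with
  | root X =>
    have hid : S (𝟙 X) := hT _ _ ⟨⟩
    rw [(Sieve.id_mem_iff_eq_top).1 hid, Sieve.pullback_top]
    exact ⟨.root Y, fun _ _ _ ↦ trivial⟩
  | node R hR sub ih =>
    obtain ⟨R', hR', hle⟩ := hB f R hR
    refine refines_node hR' fun W h hh ↦ ?_
    obtain ⟨Z, k, g, hg, fac⟩ := hle _ _ hh
    rw [← Sieve.pullback_comp, ← fac, Sieve.pullback_comp]
    exact ih g hg _ fun V l hl ↦ hT _ _ (Presieve.bind_comp (R := fun _ f hf ↦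
      (sub f hf).multicomposite) g hg hl)

/-- Cotrees are grafted onto the leaves of a cotree for `S`. -/
lemma Refines.transitive {X : C} {S : Sieve X} (hS : Refines B S) {R : Sieve X}
    (h : ∀ ⦃Y : C⦄ (f : Y ⟶ X), S f → Refines B (R.pullback f)) : Refines B R := by
  obtain ⟨T, hT⟩ := hS
  induction T with
  | root X => simpa using h (𝟙 X) (hT _ _ ⟨⟩)
  | node R₀ hR₀ sub ih =>
    refine refines_node hR₀ fun Y f hf ↦ ih f hf (S := S.pullback f) (fun Z g hg ↦ ?_) ?_
    · rw [← Sieve.pullback_comp]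
      exact h _ hg
    · exact fun Z g hg ↦ hT _ _ (Presieve.bind_comp (R := fun _ f hf ↦
        (sub f hf).multicomposite) f hf hg)

/-- If `B` is stable under pullback up to refinement, the sieves that contain the multicomposite
of a cotree of presieves in `B` form a Grothendieck topology. -/
def cotreeTopology (B : Precoverage C)
    (hB : ∀ ⦃X Y : C⦄ (f : Y ⟶ X) (R : Presieve X), R ∈ B X →
      ∃ R' ∈ B Y, R' ≤ ((Sieve.generate R).pullback f).arrows) : GrothendieckTopology C where
  sieves _ := {S | Refines B S}
  top_mem' _ := ⟨.root _, fun _ _ _ ↦ trivial⟩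
  pullback_stable' _ _ _ f hS := hS.pullback hB f
  transitive' _ _ hS _ hR := hS.transitive hR

end Cotrees

section CountablyGenerated

variable {C : Type u} [Category.{v} C]

/-- The presieves underlying the pullbacks of the sieves of a given family. -/
def pullbackPrecoverage (F : Set (Σ X : C, Sieve X)) : Precoverage C where
  coverings X := {R | ∃ s ∈ F, ∃ f : X ⟶ s.1, R = (s.2.pullback f).arrows}

lemma pullbackPrecoverage_pullback (F : Set (Σ X : C, Sieve X)) ⦃X Y : C⦄ (f : Y ⟶ X)
    (R : Presieve X) (hR : R ∈ pullbackPrecoverage F X) :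
    ∃ R' ∈ pullbackPrecoverage F Y, R' ≤ ((Sieve.generate R).pullback f).arrows := by
  obtain ⟨s, hs, g, rfl⟩ := hR
  refine ⟨_, ⟨s, hs, f ≫ g, rfl⟩, ?_⟩
  rw [Sieve.generate_sieve, Sieve.pullback_comp]

lemma countable_pullbackPrecoverage [CountableCategory C] {F : Set (Σ X : C, Sieve X)}
    (hF : F.Countable) (X : C) : (pullbackPrecoverage F X).Countable := by
  have : (⋃ s ∈ F, Set.range fun f : X ⟶ s.1 ↦ (s.2.pullback f).arrows).Countable :=
    hF.biUnion fun s _ ↦ Set.countable_range _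
  refine this.mono ?_
  rintro R ⟨s, hs, f, rfl⟩
  exact Set.mem_biUnion hs ⟨f, rfl⟩

lemma isOmegaWoven_of_isCountablyGenerated [CountableCategory C] {J : GrothendieckTopology C}
    (hJ : IsCountablyGenerated J) : IsOmegaWoven J := by
  obtain ⟨F, hF, hmem, hleast⟩ := hJ
  refine ⟨pullbackPrecoverage F, ⟨?_, pullbackPrecoverage_pullback F, fun X S hS ↦ ?_⟩,
    countable_pullbackPrecoverage hF⟩
  · rintro X _ ⟨s, hs, f, rfl⟩
    rw [Sieve.generate_sieve]
    exact J.pullback_stable f (hmem s hs)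
  · have hle : J ≤ cotreeTopology _ (pullbackPrecoverage_pullback F) :=
      hleast fun s hs ↦ refines_of_mem_of_le (B := pullbackPrecoverage F) (R := s.2.arrows)
        ⟨s, hs, 𝟙 _, by rw [Sieve.pullback_id]⟩ le_rfl
    exact hle X hS

end CountablyGenerated

section Sequences

variable {C : Type u} [Category.{v} C]

/-- A stage in the construction of a sequence of objects over `X` along which a sieve `S` is not
covering, together with the covering sieves that are still to be met, in a double sequence. -/
structure Stage (J : GrothendieckTopology C) {X : C} (S : Sieve X) where
  /-- the current object -/
  obj : C
  /-- its projection to `X` -/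
  proj : obj ⟶ X
  notMem : S.pullback proj ∉ J obj
  /-- the covering sieves to be met -/
  task : ℕ → ℕ → Sieve obj
  task_mem : ∀ n i, task n i ∈ J obj

variable {J : GrothendieckTopology C} {X : C} {S : Sieve X}

/-- Otherwise the transitivity axiom would make the pullback of `S` covering. -/
lemma Stage.exists_step (s : Stage J S) (n i : ℕ) :
    ∃ (Y : C) (g : Y ⟶ s.obj), s.task n i g ∧ S.pullback (g ≫ s.proj) ∉ J Y := by
  by_contra! h
  refine s.notMem (J.transitive (s.task_mem n i) _ fun Y g hg ↦ ?_)
  rw [← Sieve.pullback_comp]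
  exact h Y g hg

variable (e : ∀ Y : C, ℕ → Sieve Y) (he : ∀ Y i, e Y i ∈ J Y)

/-- The stage that meets the `k`-th sieve of a stage, in the enumeration of pairs, and adds the
sieves `e` on the new object as the `k + 1`-st sequence. -/
noncomputable def Stage.next (s : Stage J S) (k : ℕ) : Stage J S where
  obj := (s.exists_step k.unpair.1 k.unpair.2).choose
  proj := (s.exists_step k.unpair.1 k.unpair.2).choose_spec.choose ≫ s.proj
  notMem := (s.exists_step k.unpair.1 k.unpair.2).choose_spec.choose_spec.2
  task n i := if n = k + 1 then e _ i else
    (s.task n i).pullback (s.exists_step k.unpair.1 k.unpair.2).choose_spec.choose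
  task_mem n i := by
    split_ifs
    · exact he _ _
    · exact J.pullback_stable _ (s.task_mem n i)

/-- The projection from the next stage. -/
noncomputable def Stage.step (s : Stage J S) (k : ℕ) : (s.next e he k).obj ⟶ s.obj :=
  (s.exists_step k.unpair.1 k.unpair.2).choose_spec.choose

lemma Stage.task_step (s : Stage J S) (k : ℕ) :
    s.task k.unpair.1 k.unpair.2 (s.step e he k) :=
  (s.exists_step k.unpair.1 k.unpair.2).choose_spec.choose_spec.1

/-- The sequence of stages that starts at `X`. -/
noncomputable def stages (hS : S ∉ J X) : ℕ → Stage J S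
  | 0 =>
    { obj := X
      proj := 𝟙 X
      notMem := by simpa using hS
      task _ := e X
      task_mem _ := he X }
  | k + 1 => (stages hS k).next e he k

lemma stages_task_self (hS : S ∉ J X) (n i : ℕ) :
    (stages e he hS n).task n i = e (stages e he hS n).obj i := by
  cases n with
  | zero => rfl
  | succ k => exact if_pos rfl

/-- The underlying sequence of objects of the sequence of stages. -/
noncomputable def stagesFunctor (hS : S ∉ J X) : ℕᵒᵖ ⥤ C :=
  Functor.ofOpSequence (X := fun n ↦ (stages e he hS n).obj)
    fun n ↦ (stages e he hS n).step e he n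

/-- The transition morphisms of the sequence of stages. -/
noncomputable def stagesMap (hS : S ∉ J X) {n m : ℕ} (h : n ≤ m) :
    (stages e he hS m).obj ⟶ (stages e he hS n).obj :=
  (stagesFunctor e he hS).map (homOfLE h).op

lemma stagesMap_self (hS : S ∉ J X) (n : ℕ) : stagesMap e he hS (le_refl n) = 𝟙 _ :=
  (stagesFunctor e he hS).map_id _

lemma stagesMap_le_succ (hS : S ∉ J X) {n m : ℕ} (h : n ≤ m) :
    stagesMap e he hS (h.trans m.le_succ) =
      (stages e he hS m).step e he m ≫ stagesMap e he hS h := by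
  have h₁ : (stages e he hS m).step e he m = stagesMap e he hS m.le_succ :=
    (Functor.ofOpSequence_map_homOfLE_succ (X := fun n ↦ (stages e he hS n).obj)
      (fun n ↦ (stages e he hS n).step e he n) m).symm
  rw [h₁]
  exact (stagesFunctor e he hS).map_comp (homOfLE m.le_succ).op (homOfLE h).op

lemma stages_task (hS : S ∉ J X) {n m : ℕ} (h : n ≤ m) (i : ℕ) :
    (stages e he hS m).task n i =
      (e (stages e he hS n).obj i).pullback (stagesMap e he hS h) := by
  induction m, h using Nat.le_induction with
  | base => rw [stages_task_self, stagesMap_self, Sieve.pullback_id]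
  | succ m h ih =>
    rw [stagesMap_le_succ e he hS h]
    refine (if_neg (by omega)).trans ?_
    rw [ih]
    exact (Sieve.pullback_comp _).symm

lemma stages_proj (hS : S ∉ J X) (n : ℕ) :
    stagesMap e he hS n.zero_le ≫ (stages e he hS 0).proj = (stages e he hS n).proj := by
  induction n with
  | zero => rw [stagesMap_self, Category.id_comp]
  | succ n ih =>
    rw [stagesMap_le_succ e he hS n.zero_le]
    exact (Category.assoc _ _ _).trans (congrArg (_ ≫ ·) ih)

include he in
/-- Given countably many covering sieves `e Y` on every object `Y`, and a sieve `S` on `X` that is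
not covering, there is a sequence of objects over `X` that does not factor through `S`, and
eventually factors through each of the sieves `e` on its members. -/
lemma exists_sequence (hS : S ∉ J X) : ∃ (p : ℕᵒᵖ ⥤ C) (x : p.obj (op 0) ⟶ X),
    (∀ n : ℕ, ¬ S (p.map (homOfLE n.zero_le).op ≫ x)) ∧
      ∀ n i : ℕ, ∃ (m : ℕ) (h : n ≤ m), e (p.obj (op n)) i (p.map (homOfLE h).op) := by
  refine ⟨stagesFunctor e he hS, (stages e he hS 0).proj, fun n hn ↦ ?_, fun n i ↦ ?_⟩
  · replace hn : S (stages e he hS n).proj := stages_proj e he hS n ▸ hn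
    refine (stages e he hS n).notMem ?_
    rw [S.pullback_eq_top_of_mem hn]
    exact J.top_mem _
  -- Task `(n, i)` is met in passing from stage `Nat.pair n i` to the next; by then row `n` has been
  -- set.
  · have hk : n ≤ Nat.pair n i := Nat.left_le_pair n i
    refine ⟨Nat.pair n i + 1, hk.trans (Nat.le_succ _), ?_⟩
    have := (stages e he hS (Nat.pair n i)).task_step e he (Nat.pair n i)
    rw [Nat.unpair_pair, stages_task e he hS hk] at this
    change (e (stages e he hS n).obj i) (stagesMap e he hS (hk.trans (Nat.le_succ _)))
    rw [stagesMap_le_succ e he hS hk]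
    exact this

end Sequences

section EnoughPoints

/-- The sequence meets the pullback of the root presieve at some stage, which yields a map into the
root of a subtree; the induction continues from there. -/
lemma exists_map_of_cotree {C : Type u} [Category.{v} C] {B : Precoverage C}
    (hB : ∀ ⦃X Y : C⦄ (f : Y ⟶ X) (R : Presieve X), R ∈ B X →
      ∃ R' ∈ B Y, R' ≤ ((Sieve.generate R).pullback f).arrows)
    (p : ℕᵒᵖ ⥤ C)
    (hp : ∀ (n : ℕ) (R : Presieve (p.obj (op n))), R ∈ B _ →
      ∃ (m : ℕ) (h : n ≤ m), Sieve.generate R (p.map (homOfLE h).op))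
    {Y : C} (T : Cotree B Y) (n : ℕ) (f : p.obj (op n) ⟶ Y) :
    ∃ (m : ℕ) (h : n ≤ m),
      Sieve.generate T.multicomposite (p.map (homOfLE h).op ≫ f) := by
  induction T generalizing n with
  | root X => exact ⟨n, le_rfl, _, p.map (homOfLE le_rfl).op ≫ f, 𝟙 X, ⟨⟩, by simp⟩
  | node R hR sub ih =>
    obtain ⟨R', hR', hle⟩ := hB f R hR
    obtain ⟨m, hm, W, a, b, hb, fac⟩ := hp n R' hR'
    obtain ⟨Z, k, g, hg, fac'⟩ := hle _ _ hb
    obtain ⟨l, hl, V, c, d, hd, fac''⟩ := ih g hg m (a ≫ k)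
    refine ⟨l, hm.trans hl, V, c, d ≫ g, Presieve.bind_comp (R := fun _ f hf ↦
      (sub f hf).multicomposite) g hg hd, ?_⟩
    have : p.map (homOfLE (hm.trans hl)).op =
        p.map (homOfLE hl).op ≫ p.map (homOfLE hm).op := by
      rw [← p.map_comp]
      rfl
    rw [← Category.assoc, fac'', this, ← fac]
    simp [fac']

variable {C : Type u} [SmallCategory C] {J : GrothendieckTopology C}

open GrothendieckTopology.Point in
lemma exists_point_of_notMem (hJ : IsOmegaWoven J) {X : C} {S : Sieve X} (hS : S ∉ J X) :
    ∃ (Φ : GrothendieckTopology.Point.{u} J) (x : Φ.fiber.obj X),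
      ∀ (Y : C) (g : Y ⟶ X), S g → ∀ y : Φ.fiber.obj Y, Φ.fiber.map g y ≠ x := by
  obtain ⟨B, hB, hcount⟩ := hJ
  -- Inserting `⊤` makes the set nonempty, hence the range of a sequence.
  have (Y : C) : ∃ e : ℕ → Sieve Y, insert ⊤ (Sieve.generate '' B Y) = Set.range e :=
    (((hcount Y).image _).insert _).exists_eq_range (Set.insert_nonempty _ _)
  choose e he using this
  have hmem (Y : C) (i : ℕ) : e Y i ∈ J Y := by
    have : e Y i ∈ insert ⊤ (Sieve.generate '' B Y) := he Y ▸ Set.mem_range_self i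
    obtain h | ⟨R, hR, h⟩ := this
    · exact h ▸ J.top_mem Y
    · exact h ▸ hB.covering R hR
  obtain ⟨p, x, hx, hp⟩ := exists_sequence e hmem hS
  have hp' (n : ℕ) (R : Presieve (p.obj (op n))) (hR : R ∈ B _) :
      ∃ (m : ℕ) (h : n ≤ m), Sieve.generate R (p.map (homOfLE h).op) := by
    have : Sieve.generate R ∈ Set.range (e (p.obj (op n))) :=
      he _ ▸ Set.mem_insert_of_mem _ ⟨R, hR, rfl⟩
    obtain ⟨i, hi⟩ := this
    exact hi ▸ hp n i
  have : LocallySmall.{u} ℕᵒᵖ := ⟨fun _ _ ↦ inferInstance⟩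
  have : Small.{u} ℕᵒᵖ := small_of_injective unop_injective
  have : EssentiallySmall.{u} ℕᵒᵖ := essentiallySmall_of_small_of_locallySmall _
  have : InitiallySmall.{u} ℕᵒᵖ := initiallySmall_of_essentiallySmall _
  refine ⟨ofIsCofiltered p fun Y R hR U f ↦ ?_, ofIsCofiltered.fiberMk x, fun Y g hg y hy ↦ ?_⟩
  · obtain ⟨T, hT⟩ := hB.multicomposite R hR
    obtain ⟨m, h, Z, a, g, hg, fac⟩ := exists_map_of_cotree hB.pullback p hp' T U.unop f
    exact ⟨Z, g, hT _ _ hg, op m, (homOfLE h).op, a, fac⟩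
  · obtain ⟨⟨n⟩, a, rfl⟩ := ofIsCofiltered.fiberMk_jointly_surjective y
    have h : ofIsCofiltered.fiberMk.{u} (a ≫ g) =
        ofIsCofiltered.fiberMk (p.map (homOfLE n.zero_le).op ≫ x) := by
      rw [ofIsCofiltered.fiberMk_map_comp, ← hy]
      exact (ofIsCofiltered.fiber_map_fiberMk p a g).symm
    -- Equal germs agree at a later stage `m`, so `p m ⟶ X` would factor through `g`, hence lie in
    -- `S`.
    obtain ⟨⟨m⟩, q, hq⟩ := ofIsCofiltered.exists_of_fiberMk_eq_fiberMk h
    have hmap : p.map (homOfLE m.zero_le).op = p.map q ≫ p.map (homOfLE n.zero_le).op := by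
      rw [← p.map_comp]
      rfl
    refine hx m ?_
    rw [hmap, Category.assoc, ← hq, ← Category.assoc]
    exact S.downward_closed hg _

/-- The geometric morphism given by a point of a site. -/
noncomputable def toposPoint (Φ : GrothendieckTopology.Point.{u} J) :
    ToposPoint.{u} (Sheaf J (Type u)) where
  inverseImage := Φ.sheafFiber
  directImage := Φ.skyscraperSheafFunctor
  adj := Φ.skyscraperSheafAdjunction
  lex := inferInstance

lemma hasEnoughPoints_of_isOmegaWoven (hJ : IsOmegaWoven J) :
    HasEnoughPoints.{u} (Sheaf J (Type u)) := by
  choose Φ x hΦ using fun s : {s : Σ X : C, Sieve X // s.2 ∉ J s.1} ↦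
    exists_point_of_notMem hJ s.2
  have hP : (ObjectProperty.ofObj Φ).IsConservativeFamilyOfPoints := by
    refine .mk' fun X S h ↦ ?_
    by_contra hS
    obtain ⟨Y, g, hg, y, hy⟩ :=
      h ⟨Φ ⟨⟨X, S⟩, hS⟩, ObjectProperty.ofObj_apply _ _⟩ (x ⟨⟨X, S⟩, hS⟩)
    exact hΦ ⟨⟨X, S⟩, hS⟩ Y g hg y hy
  refine ⟨_, fun s ↦ toposPoint (Φ s), ⟨fun {_ _ f g} h ↦ ?_⟩⟩
  refine (hP.jointlyFaithful (Type u)).map_injective ?_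
  rintro ⟨_, ⟨s⟩⟩
  exact h s

end EnoughPoints

end WovenSite

theorem theorem3p9 {C : Type u} [SmallCategory C] [HasPullbacks C] (J : GrothendieckTopology C) :
    (WovenSite.IsOmegaWoven J → WovenSite.HasEnoughPoints.{u} (Sheaf J (Type u))) ∧
      (CountableCategory C → WovenSite.IsCountablyGenerated J →
        WovenSite.IsOmegaWoven J ∧ WovenSite.HasEnoughPoints.{u} (Sheaf J (Type u))) := by
  refine ⟨WovenSite.hasEnoughPoints_of_isOmegaWoven, fun _ hJ ↦ ?_⟩
  have h := WovenSite.isOmegaWoven_of_isCountablyGenerated hJ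
  exact ⟨h, WovenSite.hasEnoughPoints_of_isOmegaWoven h⟩
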